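/- Let $B$ be a topological space and $g \ge 0$ an integer. Let $\widetilde H$ be a local (twisted) coefficient system on $B$: a functor $x \mapsto \widetilde H_x$ from the fundamental groupoid of $B$ to abelian groups (for instance the fibres of a bundle of abelian groups with discrete structure group, with transport along paths). Suppose that every fibre $\widetilde H_x$ is a free abelian group of rank at most $2g$. Let $H^*(B;-)$ denote singular cohomology with local coefficients: an $n$-cochain assigns to each singular simplex $\sigma\colon \Delta^n \to B$ an element of the fibre over $\sigma(v_0)$, and the coboundary is the alternating sum over the faces, with values transported to $\sigma(v_0)$ along $\sigma$. Let $$\cup\colon H^p(B;\widetilde A)\otimes H^q(B;\widetilde C)\to H^{p+q}(B;\widetilde A\otimes\widetilde C)$$ be the twisted cup product, induced by $(a\cup c)(\sigma) = a(\sigma|_{[v_0,\dots,v_p]})\otimes T\,c(\sigma|_{[v_p,\dots,v_{p+q}]})$, where $T$ is transport along $\sigma$ from $\sigma(v_p)$ to $\sigma(v_0)$. For $\iota\in H^d(B;\widetilde H)$ write $\iota^n = \iota\cup\dots\cup\iota \in H^{nd}(B;\widetilde H^{\otimes n})$ for the $n$-fold cup power. If $\iota\in H^d(B;\widetilde H)$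 with $d$ odd, then $$(2g+1)!\cdot \iota^{2g+1} = 0 \quad\text{in}\quad H^{(2g+1)d}\bigl(B;\widetilde H^{\otimes(2g+1)}\bigr).$$ -/

import Mathlib

universe u v w

noncomputable section

namespace TwistedCohomology

open CategoryTheory
open scoped TensorProduct

/-! ## Tensor powers of abelian groups -/

section Append

variable {M : Type v} {N : Type w} [AddCommGroup M] [AddCommGroup N]

/-- The isomorphism `M^{⊗ n} ⊗ M ≅ M^{⊗ (n + 1)}`,
`(m₁ ⊗ ⋯ ⊗ mₙ) ⊗ m ↦ m₁ ⊗ ⋯ ⊗ mₙ ⊗ m`. -/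
def appendEquiv (M : Type v) [AddCommGroup M] (n : ℕ) :
    ((⨂[ℤ]^n M) ⊗[ℤ] M) ≃ₗ[ℤ] ⨂[ℤ]^(n + 1) M :=
  (TensorProduct.congr (LinearEquiv.refl ℤ _)
    (PiTensorProduct.subsingletonEquiv (R := ℤ) (s := fun _ : Fin 1 => M) 0).symm).trans
    TensorPower.mulEquiv

theorem appendEquiv_tprod (n : ℕ) (f : Fin n → M) (m : M) :
    appendEquiv M n (PiTensorProduct.tprod ℤ f ⊗ₜ[ℤ] m) =
      PiTensorProduct.tprod ℤ (Fin.snoc f m : Fin (n + 1) → M) := by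
  have h := TensorPower.tprod_mul_tprod ℤ f (fun _ : Fin 1 => m)
  rw [TensorPower.gMul_def, Fin.append_right_eq_snoc] at h
  exact (congrArg (fun z => TensorPower.mulEquiv (R := ℤ) (PiTensorProduct.tprod ℤ f ⊗ₜ[ℤ] z))
    (PiTensorProduct.subsingletonEquiv_symm_apply' (R := ℤ) (0 : Fin 1) m)).trans h

theorem appendEquiv_naturality (n : ℕ) (φ : M →ₗ[ℤ] N) :
    (appendEquiv N n).toLinearMap ∘ₗ TensorProduct.map (PiTensorProduct.map fun _ => φ) φ =
      (PiTensorProduct.map fun _ => φ) ∘ₗ (appendEquiv M n).toLinearMap := by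
  ext f m
  change appendEquiv N n (PiTensorProduct.map (fun _ => φ) (PiTensorProduct.tprod ℤ f) ⊗ₜ[ℤ] φ m) =
    PiTensorProduct.map (fun _ => φ) (appendEquiv M n (PiTensorProduct.tprod ℤ f ⊗ₜ[ℤ] m))
  rw [PiTensorProduct.map_tprod, appendEquiv_tprod, appendEquiv_tprod, PiTensorProduct.map_tprod]
  congr 1
  funext i
  refine Fin.lastCases ?_ (fun i => ?_) i <;> simp

end Append

/-! ## Local coefficient systems -/

/-- A local (twisted) coefficient system of abelian groups on a space `B`: an abelian group
`H_x` for every point `x`, and for every homotopy class (rel endpoints) of paths from `x` to `y`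
a transport homomorphism `H_x → H_y`, functorially for the concatenation of paths. For a bundle of
abelian groups with discrete structure group this is the system of its fibres, with transport along
paths. -/
abbrev LocalSystem (B : Type u) [TopologicalSpace B] : Type _ :=
  FundamentalGroupoid B ⥤ AddCommGrpCat.{v}

namespace LocalSystem

variable {B : Type u} [TopologicalSpace B]

/-- The fibre of a local system at a point. -/
abbrev fiber (H : LocalSystem.{u, v} B) (x : B) : Type v := H.obj ⟨x⟩

/-- Transport along a homotopy class of paths. -/
abbrev transport (H : LocalSystem.{u, v} B) {x y : FundamentalGroupoid B} (γ : x ⟶ y) :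
    H.obj x →+ H.obj y := (H.map γ).hom

/-- The tensor product of two local systems, formed fibrewise over `ℤ`. -/
def tensor (H : LocalSystem.{u, v} B) (K : LocalSystem.{u, w} B) :
    LocalSystem.{u, max v w} B where
  obj x := AddCommGrpCat.of (H.obj x ⊗[ℤ] K.obj x)
  map γ := AddCommGrpCat.ofHom (TensorProduct.map (H.transport γ).toIntLinearMap
    (K.transport γ).toIntLinearMap).toAddMonoidHom
  map_id x := by
    ext z
    induction z using TensorProduct.induction_on with
    | zero => exact map_zero _
    | tmul a b => simp [transport]
    | add a b ha hb => rw [map_add, ha, hb, map_add]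
  map_comp γ γ' := by
    ext z
    induction z using TensorProduct.induction_on with
    | zero => rw [map_zero, map_zero]
    | tmul a b => simp [transport]
    | add a b ha hb => rw [map_add, ha, hb, map_add]

/-- The `n`-th tensor power of a local system, formed fibrewise over `ℤ`. -/
def tensorPower (H : LocalSystem.{u, v} B) (n : ℕ) : LocalSystem.{u, v} B where
  obj x := AddCommGrpCat.of (⨂[ℤ]^n (H.obj x))
  map γ := AddCommGrpCat.ofHom
    (PiTensorProduct.map fun _ => (H.transport γ).toIntLinearMap).toAddMonoidHom
  map_id x := by
    have h : (H.transport (𝟙 x)).toIntLinearMap = LinearMap.id := by ext; simp [transport]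
    ext z
    simp [h]
  map_comp γ γ' := by
    have h : (H.transport (γ ≫ γ')).toIntLinearMap =
        (H.transport γ').toIntLinearMap ∘ₗ (H.transport γ).toIntLinearMap := by
      ext; simp [transport]
    ext z
    simp [h, PiTensorProduct.map_comp]

/-- The isomorphism `H^{⊗ n} ⊗ H ≅ H^{⊗ (n + 1)}`, given fibrewise by `appendEquiv`, as a
morphism of local systems. -/
def tensorPowerSucc (H : LocalSystem.{u, v} B) (n : ℕ) :
    (H.tensorPower n).tensor H ⟶ H.tensorPower (n + 1) where
  app x := AddCommGrpCat.ofHom (appendEquiv (H.obj x) n).toLinearMap.toAddMonoidHom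
  naturality x y γ := by
    ext z
    exact LinearMap.congr_fun (appendEquiv_naturality n (H.transport γ).toIntLinearMap) z

end LocalSystem

/-! ## Singular simplices -/

/-- The standard topological `n`-simplex. -/
abbrev Simplex (n : ℕ) : Type := stdSimplex ℝ (Fin (n + 1))

/-- The leading vertex of the standard simplex. -/
abbrev v₀ (n : ℕ) : Simplex n := stdSimplex.vertex 0

/-- The affine map of standard simplices given by a map of the vertices. -/
def affine {m n : ℕ} (f : Fin (m + 1) → Fin (n + 1)) : C(Simplex m, Simplex n) :=
  ⟨stdSimplex.map f, stdSimplex.continuous_map f⟩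

instance (n : ℕ) : ContractibleSpace (Simplex n) :=
  (convex_stdSimplex ℝ (Fin (n + 1))).contractibleSpace
    ⟨_, single_mem_stdSimplex ℝ (0 : Fin (n + 1))⟩

theorem hom_ext {n : ℕ} {s t : FundamentalGroupoid (Simplex n)} (γ γ' : s ⟶ t) : γ = γ' :=
  Subsingleton.elim (α := Path.Homotopic.Quotient s.as t.as) γ γ'

/-- The unique homotopy class of paths between two points of the standard simplex. -/
def simplexPath {n : ℕ} (s t : Simplex n) :
    (FundamentalGroupoid.mk s : FundamentalGroupoid (Simplex n)) ⟶ FundamentalGroupoid.mk t :=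
  (PathConnectedSpace.somePath s t : Path s t) |> Path.Homotopic.Quotient.mk

section Cochains

variable {B : Type u} [TopologicalSpace B]

/-- For a singular simplex `σ : Δⁿ → B` and points `s, t` of `Δⁿ`, the homotopy class of the image
under `σ` of any path from `s` to `t` in `Δⁿ`. -/
def path {n : ℕ} (σ : C(Simplex n, B)) (s t : Simplex n) :
    (FundamentalGroupoid.mk (σ s) : FundamentalGroupoid B) ⟶ FundamentalGroupoid.mk (σ t) :=
  (FundamentalGroupoid.map σ).map (simplexPath s t)

theorem path_self {n : ℕ} (σ : C(Simplex n, B)) (s : Simplex n) : path σ s s = 𝟙 _ := by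
  rw [path, hom_ext (simplexPath s s) (𝟙 _), CategoryTheory.Functor.map_id]; rfl

theorem path_comp {n : ℕ} (σ : C(Simplex n, B)) (s t r : Simplex n) :
    path σ s t ≫ path σ t r = path σ s r := by
  simp only [path]
  rw [hom_ext (simplexPath s r) (simplexPath s t ≫ simplexPath t r),
    CategoryTheory.Functor.map_comp]
  rfl

theorem path_pull {m n : ℕ} (σ : C(Simplex n, B)) (φ : C(Simplex m, Simplex n)) (s t : Simplex m) :
    path (σ.comp φ) s t = path σ (φ s) (φ t) := by
  simp only [path]
  rw [hom_ext (simplexPath (φ s) (φ t)) ((FundamentalGroupoid.map φ).map (simplexPath s t))]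
  exact Path.Homotopic.Quotient.map_comp (p := simplexPath s t) (f := φ) (g := σ)

/-- Singular `n`-cochains of `B` with coefficients in the local system `H`: functions assigning to
each singular simplex `σ : Δⁿ → B` an element of the fibre of `H` at the leading vertex of `σ`. -/
abbrev Cochain (H : LocalSystem.{u, v} B) (n : ℕ) : Type max u v :=
  ∀ σ : C(Simplex n, B), H.fiber (σ (v₀ n))

variable (H : LocalSystem.{u, v} B) (K : LocalSystem.{u, w} B)

/-- The map on cochains induced by `φ : Δᵐ → Δⁿ`: evaluate on `σ ∘ φ` and transport the value from
`σ (φ v₀)` to `σ v₀` inside `σ`. -/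
def push {m n : ℕ} (φ : C(Simplex m, Simplex n)) : Cochain H m →+ Cochain H n where
  toFun c σ := H.transport (path σ (φ (v₀ m)) (v₀ n)) (c (σ.comp φ))
  map_add' c c' := by ext σ; exact map_add _ _ _
  map_zero' := by ext σ; exact map_zero _

/-- The coboundary `δ : Cⁿ(B; H) → Cⁿ⁺¹(B; H)`, the alternating sum over the faces; only the
face opposite to the leading vertex involves a nontrivial transport. -/
def coboundary (n : ℕ) : Cochain H n →+ Cochain H (n + 1) :=
  ∑ i : Fin (n + 2), (-1 : ℤ) ^ (i : ℕ) • push H (affine i.succAbove)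

theorem coboundary_apply (n : ℕ) (c : Cochain H n) : coboundary H n c =
    ∑ i : Fin (n + 2), (-1 : ℤ) ^ (i : ℕ) • push H (affine i.succAbove) c := by
  simp only [coboundary, AddMonoidHom.finsetSum_apply, AddMonoidHom.zsmul_apply]

theorem affine_comp {l m n : ℕ} (f : Fin (m + 1) → Fin (n + 1)) (g : Fin (l + 1) → Fin (m + 1)) :
    (affine f).comp (affine g) = affine (f ∘ g) := by
  ext1 x
  exact stdSimplex.map_comp_apply g f x

theorem push_push {l m n : ℕ} (ψ : C(Simplex m, Simplex n)) (φ : C(Simplex l, Simplex m))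
    (c : Cochain H l) : push H ψ (push H φ c) = push H (ψ.comp φ) c := by
  ext σ
  change H.transport (path σ _ _) (H.transport (path (σ.comp ψ) _ _) _) =
    H.transport (path σ (ψ (φ (v₀ l))) _) _
  rw [path_pull, ← path_comp σ (ψ (φ (v₀ l))) (ψ (v₀ m)) (v₀ n)]
  simp only [LocalSystem.transport, Functor.map_comp]
  rfl

theorem coboundary_coboundary (n : ℕ) (c : Cochain H n) :
    coboundary H (n + 1) (coboundary H n c) = 0 := by
  simp only [coboundary_apply, map_sum, map_zsmul, push_push, affine_comp, Finset.smul_sum,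
    smul_smul]
  rw [← Finset.sum_product', Finset.univ_product_univ]
  let P := Fin (n + 2) × Fin (n + 3)
  let S : Finset P := {ij : P | (ij.2 : ℕ) ≤ (ij.1 : ℕ)}
  rw [← Finset.sum_add_sum_compl S, ← eq_neg_iff_add_eq_zero, ← Finset.sum_neg_distrib]
  let φ : ∀ ij : P, ij ∈ S → P := fun ij hij =>
    (Fin.castLT ij.2 (lt_of_le_of_lt (Finset.mem_filter.mp hij).right (Fin.is_lt ij.1)), ij.1.succ)
  apply Finset.sum_bij φ
  · intro ij hij
    simp_rw [S, φ, Finset.compl_filter, Finset.mem_filter_univ, Fin.val_succ,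
      Fin.val_castLT] at hij ⊢
    lia
  · rintro ⟨i, j⟩ hij ⟨i', j'⟩ hij' h
    rw [Prod.mk_inj]
    exact ⟨by simpa [φ] using! congr_arg Prod.snd h,
      by simpa [φ, Fin.castSucc_castLT] using! congr_arg Fin.castSucc (congr_arg Prod.fst h)⟩
  · rintro ⟨i', j'⟩ hij'
    simp_rw [S, Finset.compl_filter, Finset.mem_filter_univ, not_le] at hij'
    refine ⟨(j'.pred <| ?_, Fin.castSucc i'), ?_, ?_⟩
    · rintro rfl
      simp only [Fin.val_zero, not_lt_zero] at hij'
    · simpa [S] using! Nat.le_sub_one_of_lt hij'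
    · simp only [φ, Fin.castLT_castSucc, Fin.succ_pred]
  · rintro ⟨i, j⟩ hij
    have hij' : (j : ℕ) ≤ i := by simpa [S] using hij
    dsimp only
    rw [← neg_smul]
    congr 1
    · simp only [φ, Fin.val_succ, pow_add, pow_one, mul_neg, neg_neg, mul_one]
      exact mul_comm _ _
    · congr 3
      funext k
      simp only [φ, Function.comp_apply, Fin.ext_iff, Fin.succAbove, Fin.lt_def, Fin.val_castSucc,
        Fin.val_succ, Fin.val_castLT]
      split_ifs <;> simp_all <;> omega

/-- Cocycles. -/
def cocycles (n : ℕ) : AddSubgroup (Cochain H n) := (coboundary H n).ker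

/-- Coboundaries (zero in degree `0`). -/
def coboundaries : ∀ n : ℕ, AddSubgroup (Cochain H n)
  | 0 => ⊥
  | n + 1 => (coboundary H n).range

theorem coboundaries_le_cocycles : ∀ n : ℕ, coboundaries H n ≤ cocycles H n
  | 0 => bot_le
  | n + 1 => by
    rintro _ ⟨c, rfl⟩
    exact coboundary_coboundary H n c

/-- The `n`-th singular cohomology group `Hⁿ(B; H)` with coefficients in the local system `H`. -/
abbrev Cohomology (n : ℕ) : Type max u v :=
  cocycles H n ⧸ (coboundaries H n).addSubgroupOf (cocycles H n)

variable {H K} {H' : LocalSystem.{u, v} B}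

/-- The cohomology class of a cocycle. -/
def mkClass {n : ℕ} (c : cocycles H n) : Cohomology H n := QuotientAddGroup.mk c

/-! ## Cup product -/

/-- The front `p`-face of the standard `n`-simplex, spanned by the first `p + 1` vertices. -/
def frontFace {p q n : ℕ} (h : p + q = n) : C(Simplex p, Simplex n) :=
  affine fun i => ⟨i, by omega⟩

/-- The back `q`-face of the standard `n`-simplex, spanned by the last `q + 1` vertices. -/
def backFace {p q n : ℕ} (h : p + q = n) : C(Simplex q, Simplex n) :=
  affine fun i => ⟨p + i, by omega⟩

/-- The fibrewise tensor product of two cochains of the same degree. -/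
def tmul {n : ℕ} (a : Cochain H n) (b : Cochain K n) : Cochain (H.tensor K) n :=
  fun σ => a σ ⊗ₜ[ℤ] b σ

/-- The cup product of cochains: `(a ∪ b)(σ)` is the value of `a` on the front `p`-face of `σ`,
tensored with the value of `b` on the back `q`-face of `σ` transported along `σ` from the
`p`-th vertex to the leading vertex. (The transport of the first factor is the identity.) -/
def cupCochain {p q n : ℕ} (h : p + q = n) (a : Cochain H p) (b : Cochain K q) :
    Cochain (H.tensor K) n :=
  tmul (push H (frontFace h) a) (push K (backFace h) b)

theorem push_tmul {m n : ℕ} (φ : C(Simplex m, Simplex n)) (a : Cochain H m) (b : Cochain K m) :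
    push (H.tensor K) φ (tmul a b) = tmul (push H φ a) (push K φ b) := rfl

theorem add_tmul {n : ℕ} (a a' : Cochain H n) (b : Cochain K n) :
    tmul (a + a') b = tmul a b + tmul a' b := by
  ext σ; exact TensorProduct.add_tmul _ _ _

theorem tmul_add {n : ℕ} (a : Cochain H n) (b b' : Cochain K n) :
    tmul a (b + b') = tmul a b + tmul a b' := by
  ext σ; exact TensorProduct.tmul_add _ _ _

theorem zero_tmul {n : ℕ} (b : Cochain K n) : tmul (0 : Cochain H n) b = 0 := by
  ext σ; exact TensorProduct.zero_tmul _ _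

theorem tmul_zero {n : ℕ} (a : Cochain H n) : tmul a (0 : Cochain K n) = 0 := by
  ext σ; exact TensorProduct.tmul_zero _ _

theorem smul_tmul {n : ℕ} (r : ℤ) (a : Cochain H n) (b : Cochain K n) :
    tmul (r • a) b = r • tmul a b := by
  ext σ; exact TensorProduct.smul_tmul' r (a σ) (b σ)

theorem tmul_smul {n : ℕ} (r : ℤ) (a : Cochain H n) (b : Cochain K n) :
    tmul a (r • b) = r • tmul a b := by
  ext σ; exact TensorProduct.tmul_smul r (a σ) (b σ)

theorem sum_tmul {ι : Type*} (s : Finset ι) {n : ℕ} (f : ι → Cochain H n) (b : Cochain K n) :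
    tmul (∑ i ∈ s, f i) b = ∑ i ∈ s, tmul (f i) b :=
  map_sum (AddMonoidHom.mk' (fun a => tmul a b) fun a a' => add_tmul a a' b) f s

theorem tmul_sum {ι : Type*} (s : Finset ι) {n : ℕ} (a : Cochain H n) (f : ι → Cochain K n) :
    tmul a (∑ i ∈ s, f i) = ∑ i ∈ s, tmul a (f i) :=
  map_sum (AddMonoidHom.mk' (fun b => tmul a b) fun b b' => tmul_add a b b') f s

/-- The Leibniz rule for the cup product of cochains. -/
theorem coboundary_cupCochain {p q n : ℕ} (h : p + q = n) (h₁ : p + 1 + q = n + 1)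
    (h₂ : p + (q + 1) = n + 1) (a : Cochain H p) (b : Cochain K q) :
    coboundary (H.tensor K) n (cupCochain h a b) =
      cupCochain h₁ (coboundary H p a) b + (-1 : ℤ) ^ p • cupCochain h₂ a (coboundary K q b) := by
  have split : ∀ G : Fin (n + 2) → Cochain (H.tensor K) (n + 1), ∑ i, G i =
      ∑ i : Fin (p + 1), G ⟨i, by omega⟩ + ∑ j : Fin (q + 1), G ⟨p + 1 + j, by omega⟩ := by
    intro G
    have e : p + 1 + (q + 1) = n + 2 := by omega
    rw [← (finCongr e).sum_comp, Fin.sum_univ_add]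
    rfl
  simp only [cupCochain, coboundary_apply, push_tmul, push_push, map_sum, map_zsmul, sum_tmul,
    tmul_sum, smul_tmul, tmul_smul, Finset.smul_sum, smul_smul]
  rw [split, Fin.sum_univ_castSucc (n := p + 1), Fin.sum_univ_succ (n := q + 1)]
  have A : ∀ i : Fin (p + 1), ((affine (Fin.succAbove (⟨i, by omega⟩ : Fin (n + 2)))).comp
      (frontFace h)) = (frontFace h₁).comp (affine i.castSucc.succAbove) := by
    intro i
    simp only [frontFace, affine_comp]
    congr 1
    funext k
    simp only [Function.comp_apply, Fin.ext_iff, Fin.succAbove, Fin.lt_def, Fin.val_castSucc]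
    split_ifs <;> simp
  have B : ∀ i : Fin (p + 1), ((affine (Fin.succAbove (⟨i, by omega⟩ : Fin (n + 2)))).comp
      (backFace h)) = backFace h₁ := by
    intro i
    simp only [backFace, affine_comp]
    congr 1
    funext k
    simp only [Function.comp_apply, Fin.ext_iff, Fin.succAbove, Fin.lt_def, Fin.val_castSucc]
    split_ifs <;> simp <;> omega
  have C : ∀ j : Fin (q + 1), ((affine (Fin.succAbove (⟨p + 1 + j, by omega⟩ : Fin (n + 2)))).comp
      (frontFace h)) = frontFace h₂ := by
    intro i
    simp only [frontFace, affine_comp]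
    congr 1
    funext k
    simp only [Function.comp_apply, Fin.ext_iff, Fin.succAbove, Fin.lt_def, Fin.val_castSucc]
    split_ifs <;> simp <;> omega
  have D : ∀ j : Fin (q + 1), ((affine (Fin.succAbove (⟨p + 1 + j, by omega⟩ : Fin (n + 2)))).comp
      (backFace h)) = (backFace h₂).comp (affine j.succ.succAbove) := by
    intro i
    simp only [backFace, affine_comp]
    congr 1
    funext k
    simp only [Function.comp_apply, Fin.ext_iff, Fin.succAbove, Fin.lt_def, Fin.val_castSucc,
      Fin.val_succ]
    split_ifs <;> simp <;> omega
  have E : (frontFace h₁).comp (affine (Fin.last (p + 1)).succAbove) = frontFace h₂ := by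
    simp only [frontFace, affine_comp]
    congr 1
    funext k
    simp
  have F : (backFace h₂).comp (affine (Fin.succAbove (0 : Fin (q + 2)))) = backFace h₁ := by
    simp only [backFace, affine_comp]
    congr 1
    funext k
    simp only [Function.comp_apply, Fin.ext_iff, Fin.succAbove_zero, Fin.val_succ]
    omega
  simp only [A, B, C, D, E, F]
  simp only [Fin.val_castSucc, Fin.val_last, Fin.val_succ, Fin.val_zero, pow_zero, mul_one]
  have X : ∀ u v w : Cochain (H.tensor K) (n + 1),
      u + v = u + (-1 : ℤ) ^ (p + 1) • w + ((-1 : ℤ) ^ p • w + v) := by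
    intro u v w
    rw [pow_succ, mul_neg_one, neg_smul]
    abel
  rw [← X]
  congr 1
  refine Finset.sum_congr rfl fun j _ => ?_
  congr 1
  ring

theorem cup_mem_cocycles {p q n : ℕ} (h : p + q = n) {a : Cochain H p} {b : Cochain K q}
    (ha : a ∈ cocycles H p) (hb : b ∈ cocycles K q) :
    cupCochain h a b ∈ cocycles (H.tensor K) n := by
  have ha' : coboundary H p a = 0 := ha
  have hb' : coboundary K q b = 0 := hb
  change coboundary _ n _ = 0
  rw [coboundary_cupCochain h (by omega) (by omega), ha', hb']
  simp [cupCochain, zero_tmul, tmul_zero]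

theorem cup_mem_coboundaries_right {p q n : ℕ} (h : p + q = n) {a : Cochain H p}
    {b : Cochain K q} (ha : a ∈ cocycles H p) (hb : b ∈ coboundaries K q) :
    cupCochain h a b ∈ coboundaries (H.tensor K) n := by
  have ha' : coboundary H p a = 0 := ha
  cases q with
  | zero =>
    obtain rfl : b = 0 := hb
    simp [cupCochain, tmul_zero]
  | succ q =>
    obtain ⟨c, rfl⟩ := hb
    obtain ⟨m, rfl⟩ : ∃ m, n = m + 1 := ⟨p + q, by omega⟩
    refine ⟨(-1 : ℤ) ^ p • cupCochain (by omega) a c, ?_⟩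
    rw [map_zsmul, coboundary_cupCochain (by omega) (by omega) h, ha', smul_add, smul_smul,
      ← mul_pow]
    simp [cupCochain, zero_tmul]

theorem cup_mem_coboundaries_left {p q n : ℕ} (h : p + q = n) {a : Cochain H p}
    {b : Cochain K q} (ha : a ∈ coboundaries H p) (hb : b ∈ cocycles K q) :
    cupCochain h a b ∈ coboundaries (H.tensor K) n := by
  have hb' : coboundary K q b = 0 := hb
  cases p with
  | zero =>
    obtain rfl : a = 0 := ha
    simp [cupCochain, zero_tmul]
  | succ p =>
    obtain ⟨c, rfl⟩ := ha
    obtain ⟨m, rfl⟩ : ∃ m, n = m + 1 := ⟨p + q, by omega⟩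
    refine ⟨cupCochain (by omega) c b, ?_⟩
    rw [coboundary_cupCochain (by omega) h (by omega), hb']
    simp [cupCochain, tmul_zero]

/-- The cup product of cocycles. -/
def cupCocycle {p q n : ℕ} (h : p + q = n) :
    cocycles H p →+ cocycles K q →+ cocycles (H.tensor K) n :=
  AddMonoidHom.mk' (fun a => AddMonoidHom.mk' (fun b =>
      ⟨cupCochain h a.1 b.1, cup_mem_cocycles h a.2 b.2⟩)
    fun b b' => Subtype.ext (by simp [cupCochain, tmul_add]))
    fun a a' => by ext1 b; exact Subtype.ext (by simp [cupCochain, add_tmul])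

/-- The cup product `H^p(B; H) ⊗ H^q(B; K) → H^{p+q}(B; H ⊗ K)`, as a biadditive map. -/
def cup {p q n : ℕ} (h : p + q = n) :
    Cohomology H p →+ Cohomology K q →+ Cohomology (H.tensor K) n :=
  QuotientAddGroup.lift _
    (AddMonoidHom.mk' (fun a => QuotientAddGroup.lift _
      ((QuotientAddGroup.mk' ((coboundaries (H.tensor K) n).addSubgroupOf _)).comp
        (cupCocycle h a))
      fun b hb => (QuotientAddGroup.eq_zero_iff _).2
        (cup_mem_coboundaries_right h a.2 hb))
      fun a a' => by ext b; simp only [map_add]; rfl)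
    fun a ha => by
      ext b
      exact (QuotientAddGroup.eq_zero_iff _).2 (cup_mem_coboundaries_left h ha b.2)

theorem cup_mkClass {p q n : ℕ} (h : p + q = n) (a : cocycles H p) (b : cocycles K q) :
    cup h (mkClass a) (mkClass b) =
      mkClass ⟨cupCochain h a.1 b.1, cup_mem_cocycles h a.2 b.2⟩ := rfl

/-! ## Change of coefficients -/

/-- The effect on cochains of a morphism of local systems. -/
def mapCochain (f : H ⟶ H') (n : ℕ) : Cochain H n →+ Cochain H' n where
  toFun c σ := (f.app _).hom (c σ)
  map_zero' := by ext σ; exact map_zero _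
  map_add' c c' := by ext σ; exact map_add _ _ _

theorem coboundary_mapCochain (f : H ⟶ H') (n : ℕ) (c : Cochain H n) :
    coboundary H' n (mapCochain f n c) = mapCochain f (n + 1) (coboundary H n c) := by
  simp only [coboundary_apply, map_sum, map_zsmul]
  refine Finset.sum_congr rfl fun i _ => ?_
  congr 1
  ext σ
  exact (ConcreteCategory.congr_hom (f.naturality _) _).symm

theorem mapCochain_mem_cocycles (f : H ⟶ H') (n : ℕ) {c : Cochain H n} (hc : c ∈ cocycles H n) :
    mapCochain f n c ∈ cocycles H' n := by
  have hc' : coboundary H n c = 0 := hc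
  change coboundary H' n _ = 0
  rw [coboundary_mapCochain, hc', map_zero]

theorem mapCochain_mem_coboundaries (f : H ⟶ H') (n : ℕ) {c : Cochain H n}
    (hc : c ∈ coboundaries H n) : mapCochain f n c ∈ coboundaries H' n := by
  cases n with
  | zero =>
    obtain rfl : c = 0 := hc
    simp
  | succ n =>
    obtain ⟨b, rfl⟩ := hc
    exact ⟨mapCochain f n b, coboundary_mapCochain f n b⟩

/-- The map `f_* : Hⁿ(B; H) → Hⁿ(B; H')` induced by a morphism of local systems `f : H → H'`. -/
def coeffMap (f : H ⟶ H') (n : ℕ) : Cohomology H n →+ Cohomology H' n :=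
  QuotientAddGroup.map _ _
    (((mapCochain f n).comp (cocycles H n).subtype).codRestrict (cocycles H' n)
      fun c => mapCochain_mem_cocycles f n c.2)
    fun _ hc => mapCochain_mem_coboundaries f n hc

/-! ## Cup powers -/

/-- The unit `0`-cochain with coefficients in `H^{⊗ 0} = ℤ`. -/
def oneCochain (H : LocalSystem.{u, v} B) : Cochain (H.tensorPower 0) 0 :=
  fun _ => PiTensorProduct.tprod ℤ Fin.elim0

theorem oneCochain_mem_cocycles (H : LocalSystem.{u, v} B) :
    oneCochain H ∈ cocycles (H.tensorPower 0) 0 := by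
  have h : ∀ φ : C(Simplex 0, Simplex 1), push (H.tensorPower 0) φ (oneCochain H) =
      fun _ => PiTensorProduct.tprod ℤ Fin.elim0 := by
    intro φ
    ext σ
    refine (PiTensorProduct.map_tprod _ _).trans (congrArg _ ?_)
    exact Subsingleton.elim _ _
  change coboundary _ 0 _ = 0
  rw [coboundary_apply, Fin.sum_univ_two, h, h]
  simp only [Fin.val_zero, Fin.val_one, pow_zero, pow_one, one_smul, neg_one_smul]
  exact add_neg_cancel _

/-- The cup powers `ιⁿ = ι ∪ ⋯ ∪ ι ∈ H^{dn}(B; H^{⊗ n})` of a class `ι ∈ H^d(B; H)`. -/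
def cupPow {d : ℕ} (ι : Cohomology H d) : ∀ n : ℕ, Cohomology (H.tensorPower n) (d * n)
  | 0 => mkClass ⟨oneCochain H, oneCochain_mem_cocycles H⟩
  | n + 1 => coeffMap (H.tensorPowerSucc n) (d * (n + 1))
      (cup (Nat.mul_succ d n).symm (cupPow ι n) ι)

end Cochains

end TwistedCohomology

end

noncomputable section

namespace TwistedCohomology

open CategoryTheory
open scoped TensorProduct

/-! ## The cup-one product -/

section CupOne

/-! Put n = 2g + 1. For d odd the cup product anticommutes, so permuting the tensor factors of ιⁿ by
s multiplies it by sign(s) (`coeffMap_permute_cupPow`). Applying the antisymmetrizer ∑ sign(s)·s to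
ιⁿ therefore gives n!·ιⁿ. But the fibres have rank less than n, and the antisymmetrizer is zero on
the n-th tensor power of such a group: it is alternating, and among n basis vectors two coincide
(`sum_sign_smul_permuteTensor`). Hence n!·ιⁿ = 0.

The substantial input is anticommutativity with twisted coefficients (`cup_comm_of_odd`). An
explicit cup-one product supplies the homotopy: on a simplex of dimension p + q - 1, sum over i the
value of a on the vertices 0, …, i, i + q, …, p + q - 1 tensored with the value of b on i, …, i + q.
For cocycles of odd degrees its coboundary is minus the sum of the two cup products
(`coboundary_cupOne`). All transports are absorbed into `push`, which is functorial in maps of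
simplices, so only the combinatorics of vertex maps in `sum_skip_gap` remains. -/

/-- The increasing map `ℕ → ℕ` whose image omits exactly `j`. -/
def skip (j k : ℕ) : ℕ := if k < j then k else k + 1

/-- The increasing map `ℕ → ℕ` whose image omits exactly the `q - 1` numbers after `i`. -/
def gap (q i k : ℕ) : ℕ := if k ≤ i then k else k + q - 1

/-- In a cup-one summand the second factor lives on the block i, …, i + q, and `gap q i` lists the
vertices outside the interior of that block. Passing to the face that omits j has three cases: j
before the block, inside it, or after it. -/
theorem skip_comp_gap_of_le {q i j : ℕ} (hq : 0 < q) (hj : j ≤ i) :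
    skip j ∘ gap q i = gap q (i + 1) ∘ skip j := by
  funext k
  simp only [Function.comp_apply, skip, gap]
  split_ifs <;> omega

theorem skip_comp_gap_of_mem {q i j : ℕ} (hi : i < j) (hj : j ≤ i + q) :
    skip j ∘ gap q i = gap q i ∘ skip (i + 1) := by
  funext k
  simp only [Function.comp_apply, skip, gap]
  split_ifs <;> omega

theorem skip_comp_gap_of_lt {q i t : ℕ} (hq : 0 < q) :
    skip (i + q + 1 + t) ∘ gap q i = gap q i ∘ skip (i + 2 + t) := by
  funext k
  simp only [Function.comp_apply, skip, gap]
  split_ifs <;> omega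

/-- Both sides pass over i + 1, …, i + q. This is where the boundary terms of the neighbouring
summands i and i + 1 meet and cancel. -/
theorem gap_succ_comp_skip (q i : ℕ) :
    gap q (i + 1) ∘ skip (i + 1) = gap q i ∘ skip (i + 1) := by
  funext k
  simp only [Function.comp_apply, skip, gap]
  split_ifs <;> omega

theorem skip_comp_add_of_le {i j : ℕ} (hj : j ≤ i) : skip j ∘ (i + ·) = (i + 1 + ·) := by
  funext k
  simp only [Function.comp_apply, skip]
  split_ifs <;> omega

theorem skip_comp_add (i t : ℕ) : skip (i + t) ∘ (i + ·) = (i + ·) ∘ skip t := by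
  funext k
  simp only [Function.comp_apply, skip]
  split_ifs <;> omega

/-- The combinatorial identity behind the coboundary formula for the cup-one product: `e f g`
stands for the product of the values of two cocycles of degrees `p` and `q` on the faces with
vertices `f 0, …, f p` and `g 0, …, g q`. -/
theorem sum_skip_gap {A : Type*} [AddCommGroup A] {p q : ℕ} (hp : Odd p) (hq : Odd q)
    (e : (ℕ → ℕ) → (ℕ → ℕ) → A)
    (hcongr : ∀ f f' g g', (∀ k ≤ p, f k = f' k) → (∀ k ≤ q, g k = g' k) → e f g = e f' g')
    (hleft : ∀ f g, ∑ j ∈ Finset.range (p + 2), (-1 : ℤ) ^ j • e (f ∘ skip j) g = 0)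
    (hright : ∀ f g, ∑ j ∈ Finset.range (q + 2), (-1 : ℤ) ^ j • e f (g ∘ skip j) = 0) :
    ∑ i ∈ Finset.range p, ∑ j ∈ Finset.range (p + q + 1),
      (-1 : ℤ) ^ j • e (skip j ∘ gap q i) (skip j ∘ (i + ·)) =
      -(e id (p + ·) + e (q + ·) id) := by
  have hq0 : 0 < q := hq.pos
  -- The cocycle relation of the first factor on `gap q k` deletes one vertex at a time. `P k` and
  -- `Q k` delete the block ends k and k + q; `L k` and `R k` collect the deletions before and after
  -- them.
  let P : ℕ → A := fun k => (-1 : ℤ) ^ k • e (gap q k ∘ skip k) (k + ·)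
  let Q : ℕ → A := fun k => (-1 : ℤ) ^ k • e (gap q k ∘ skip (k + 1)) (k + ·)
  let L : ℕ → A := fun k =>
    ∑ j ∈ Finset.range k, (-1 : ℤ) ^ j • e (gap q k ∘ skip j) (k + ·)
  let R : ℕ → A := fun k =>
    ∑ t ∈ Finset.range (p - k), (-1 : ℤ) ^ (k + t) • e (gap q k ∘ skip (k + 2 + t)) (k + ·)
  have hLR : ∀ k ≤ p, L k + R k = Q k - P k := by
    intro k hk
    have h := hleft (gap q k) (k + ·)
    rw [show p + 2 = k + 1 + 1 + (p - k) by omega, Finset.sum_range_add, Finset.sum_range_succ,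
      Finset.sum_range_succ] at h
    have hR : ∑ t ∈ Finset.range (p - k), (-1 : ℤ) ^ (k + 1 + 1 + t) •
        e (gap q k ∘ skip (k + 1 + 1 + t)) (k + ·) = R k :=
      Finset.sum_congr rfl fun t _ => by
        rw [show (-1 : ℤ) ^ (k + 1 + 1 + t) = (-1) ^ (k + t) by ring]
    rw [hR, pow_succ, mul_neg_one, neg_smul] at h
    change L k + P k + -Q k + R k = 0 at h
    rw [← sub_eq_zero, ← h]
    abel
  -- The cocycle relation of the second factor on i, …, i + q + 1 trades the deletions of inner
  -- vertices for those of the two ends. Because q is odd, the two ends enter that relation with the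
  -- same sign.
  have hM : ∀ i < p, ∑ t ∈ Finset.range q, (-1 : ℤ) ^ (i + 1 + t) •
      e (gap q i ∘ skip (i + 1)) ((i + ·) ∘ skip (t + 1)) = P (i + 1) - Q i := by
    intro i hi
    have h := congrArg (fun x => (-1 : ℤ) ^ i • x) (hright (gap q i ∘ skip (i + 1)) (i + ·))
    simp only [Finset.smul_sum, smul_smul, ← pow_add, smul_zero] at h
    rw [Finset.sum_range_succ, Finset.sum_range_succ'] at h
    have h0 : (i + ·) ∘ skip 0 = (i + 1 + ·) := by
      funext k; simp only [Function.comp_apply, skip]; split_ifs <;> omega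
    have h1 : e (gap q i ∘ skip (i + 1)) ((i + ·) ∘ skip (q + 1)) =
        e (gap q i ∘ skip (i + 1)) (i + ·) :=
      hcongr _ _ _ _ (fun _ _ => rfl) fun k hk => by
        simp only [Function.comp_apply, skip]; split_ifs <;> omega
    have hs : (-1 : ℤ) ^ (i + (q + 1)) = (-1) ^ i := by
      rw [pow_add, hq.add_one.neg_one_pow, mul_one]
    rw [h0, h1, hs, ← gap_succ_comp_skip] at h
    have hP : (-1 : ℤ) ^ (i + 0) • e (gap q (i + 1) ∘ skip (i + 1)) (i + 1 + ·) =
        -P (i + 1) := by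
      simp only [P, pow_succ, add_zero, mul_neg_one, neg_smul, neg_neg]
    rw [hP, gap_succ_comp_skip] at h
    change _ + -P (i + 1) + Q i = 0 at h
    rw [← sub_eq_zero, ← h, ← sub_eq_zero]
    simp only [add_assoc, add_comm 1]
    abel
  -- Split by the position of j: j ≤ i gives `L (i + 1)`, the next q values give the sum in `hM`,
  -- and the remaining p - i give `R i`.
  have hterm : ∀ i ∈ Finset.range p, ∑ j ∈ Finset.range (p + q + 1),
      (-1 : ℤ) ^ j • e (skip j ∘ gap q i) (skip j ∘ (i + ·)) =
      L (i + 1) + (P (i + 1) - Q i) + R i := by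
    intro i hi
    have hi' : i < p := Finset.mem_range.1 hi
    rw [show p + q + 1 = i + 1 + q + (p - i) by omega, Finset.sum_range_add, Finset.sum_range_add,
      ← hM i hi']
    refine congrArg₂ (· + ·) (congrArg₂ (· + ·) ?_ ?_) ?_
    · refine Finset.sum_congr rfl fun j hj => ?_
      have hj' : j ≤ i := Nat.lt_succ_iff.1 (Finset.mem_range.1 hj)
      rw [skip_comp_gap_of_le hq0 hj', skip_comp_add_of_le hj']
    · refine Finset.sum_congr rfl fun t ht => ?_
      have ht' := Finset.mem_range.1 ht
      rw [skip_comp_gap_of_mem (by omega) (by omega), add_assoc i 1 t, add_comm 1 t,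
        skip_comp_add]
    · refine Finset.sum_congr rfl fun t ht => ?_
      rw [show i + 1 + q + t = i + q + 1 + t by omega, skip_comp_gap_of_lt hq0,
        hcongr _ _ _ (i + ·) (fun _ _ => rfl) fun k hk => by
          simp only [Function.comp_apply, skip]; split_ifs <;> omega]
      congr 1
      rw [show i + q + 1 + t = i + t + (q + 1) by omega, pow_add, hq.add_one.neg_one_pow, mul_one]
  have hL0 : L 0 = 0 := by simp [L]
  have hRp : R p = 0 := by simp [R]
  have hsum : ∀ f : ℕ → A, ∑ i ∈ Finset.range p, f (i + 1) + f 0 =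
      ∑ i ∈ Finset.range p, f i + f p := fun f => by
    rw [← Finset.sum_range_succ, Finset.sum_range_succ']
  -- Sum `hLR` over 0 ≤ k ≤ p. As `L 0` and `R p` are empty, the left side is exactly the sum of the
  -- `L` and `R` terms of `hterm`; against the terms `P (i + 1) - Q i` everything cancels except `Q
  -- p - P 0`.
  have hall := Finset.sum_congr rfl fun k hk =>
    hLR k (Nat.lt_succ_iff.1 (Finset.mem_range.1 hk))
  rw [Finset.sum_add_distrib, Finset.sum_sub_distrib, Finset.sum_range_succ', hL0,
    Finset.sum_range_succ, Finset.sum_range_succ, Finset.sum_range_succ' P, hRp] at hall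
  have hP0 : P 0 = e (q + ·) id := by
    simp only [P, pow_zero, one_smul]
    congr 1
    · funext k; simp only [Function.comp_apply, skip, gap]; split_ifs <;> omega
    · funext k; simp
  -- The parity of p gives this sign, so that the two cup products appear with equal signs.
  have hQp : Q p = -e id (p + ·) := by
    simp only [Q, hp.neg_one_pow, neg_one_smul]
    rw [hcongr _ id _ _ (fun k hk => by
      simp only [Function.comp_apply, skip, gap, id]; split_ifs <;> omega) fun _ _ => rfl]
  rw [Finset.sum_congr rfl hterm]
  simp only [Finset.sum_add_distrib, Finset.sum_sub_distrib]
  rw [hP0, hQp] at hall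
  simp only [add_zero] at hall
  have : ∀ l r s t x y : A, l + r = s + -x - (t + y) → l + (t - s) + r = -(x + y) := by
    intro l r s t x y h
    rw [show l + (t - s) + r = l + r + (t - s) by abel, h]
    abel
  exact this _ _ _ _ _ _ hall

/-! ### Faces given by vertex maps, and the cup-one cochain. -/

variable {B : Type u} [TopologicalSpace B]

/-- The affine map of standard simplices which sends the `i`-th vertex to the vertex `f i`. -/
def face (n m : ℕ) (f : ℕ → ℕ) : C(Simplex m, Simplex n) :=
  affine fun i => Fin.ofNat (n + 1) (f i)

theorem face_congr {n m : ℕ} {f f' : ℕ → ℕ} (h : ∀ k ≤ m, f k = f' k) :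
    face n m f = face n m f' := by
  simp only [face]
  congr 1
  funext k
  rw [h k (Nat.lt_succ_iff.1 k.2)]

theorem val_succAbove_eq_skip {n : ℕ} (j : Fin (n + 1)) (k : Fin n) :
    (j.succAbove k : ℕ) = skip j k := by
  simp only [Fin.succAbove, skip, Fin.lt_def, Fin.val_castSucc]
  split_ifs <;> simp

/-- The bound on `f` matters: `face` reduces vertices modulo n + 1, and a value beyond n would wrap
around before `skip` acts. Precomposition with a face map needs no such bound. -/
theorem affine_succAbove_comp_face {n m : ℕ} (j : Fin (n + 2)) {f : ℕ → ℕ}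
    (h : ∀ k ≤ m, f k ≤ n) :
    (affine j.succAbove).comp (face n m f) = face (n + 1) m (skip j ∘ f) := by
  simp only [face, affine_comp]
  congr 1
  funext k
  have hk := h k (Nat.lt_succ_iff.1 k.2)
  have hs : skip j (f k) ≤ n + 1 := by simp only [skip]; split_ifs <;> omega
  simp only [Function.comp_apply, Fin.ext_iff, val_succAbove_eq_skip, Fin.val_ofNat]
  rw [Nat.mod_eq_of_lt (by omega), Nat.mod_eq_of_lt (by omega)]

theorem face_comp_affine_succAbove {n m : ℕ} (j : Fin (m + 2)) (f : ℕ → ℕ) :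
    (face n (m + 1) f).comp (affine j.succAbove) = face n m (f ∘ skip j) := by
  simp only [face, affine_comp]
  congr 1
  funext k
  simp only [Function.comp_apply, val_succAbove_eq_skip]

theorem frontFace_eq_face {p q n : ℕ} (h : p + q = n) : frontFace h = face n p id := by
  simp only [frontFace, face]
  congr 1
  funext k
  simp only [Fin.ext_iff, Fin.val_ofNat, id]
  rw [Nat.mod_eq_of_lt (by omega)]

theorem backFace_eq_face {p q n : ℕ} (h : p + q = n) : backFace h = face n q (p + ·) := by
  simp only [backFace, face]
  congr 1
  funext k
  simp only [Fin.ext_iff, Fin.val_ofNat]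
  rw [Nat.mod_eq_of_lt (by omega)]

/-- The cocycle equation pushed forward along an arbitrary, possibly degenerate, vertex map; it
supplies the two relations assumed in `sum_skip_gap`. -/
theorem sum_push_face_comp_skip (H : LocalSystem.{u, v} B) {p : ℕ} (n : ℕ) {a : Cochain H p}
    (ha : a ∈ cocycles H p) (f : ℕ → ℕ) :
    ∑ j ∈ Finset.range (p + 2), (-1 : ℤ) ^ j • push H (face n p (f ∘ skip j)) a = 0 := by
  have ha' : coboundary H p a = 0 := ha
  have h := congrArg (push H (face n (p + 1) f)) ha'
  simpa only [coboundary_apply, map_sum, map_zsmul, push_push, face_comp_affine_succAbove,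
    map_zero, Fin.sum_univ_eq_sum_range
      (fun j => (-1 : ℤ) ^ j • push H (face n p (f ∘ skip j)) a)] using h

/-- The isomorphism `H ⊗ K ≅ K ⊗ H` of local systems. -/
def LocalSystem.braid (H : LocalSystem.{u, v} B) (K : LocalSystem.{u, w} B) :
    H.tensor K ⟶ K.tensor H where
  app x := AddCommGrpCat.ofHom
    (TensorProduct.comm ℤ (H.obj x) (K.obj x)).toLinearMap.toAddMonoidHom
  naturality x y γ := by
    ext z
    exact (LinearMap.congr_fun (TensorProduct.map_comp_comm_eq (K.transport γ).toIntLinearMap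
      (H.transport γ).toIntLinearMap) z).symm

variable {H : LocalSystem.{u, v} B} {K : LocalSystem.{u, w} B}

/-- The cup-one product of cochains, with the signs for cochains of odd degrees. -/
def cupOne {p q : ℕ} (n : ℕ) (a : Cochain H p) (b : Cochain K q) : Cochain (H.tensor K) n :=
  ∑ i ∈ Finset.range p, tmul (push H (face n p (gap q i)) a) (push K (face n q (i + ·)) b)

/-- The coboundary of the cup-one product of two cocycles of odd degrees. -/
theorem coboundary_cupOne {p q n : ℕ} (hp : Odd p) (hq : Odd q) (h : p + q = n + 1)
    (h' : q + p = n + 1) {a : Cochain H p} {b : Cochain K q} (ha : a ∈ cocycles H p)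
    (hb : b ∈ cocycles K q) :
    coboundary (H.tensor K) n (cupOne n a b) =
      -(cupCochain h a b + mapCochain (K.braid H) (n + 1) (cupCochain h' b a)) := by
  let e : (ℕ → ℕ) → (ℕ → ℕ) → Cochain (H.tensor K) (n + 1) := fun f g =>
    tmul (push H (face (n + 1) p f) a) (push K (face (n + 1) q g) b)
  have key := sum_skip_gap hp hq e
    (fun f f' g g' hf hg => by simp only [e, face_congr hf, face_congr hg])
    (fun f g => by
      simp only [e, ← smul_tmul, ← sum_tmul]
      rw [sum_push_face_comp_skip H _ ha, zero_tmul])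
    (fun f g => by
      simp only [e, ← tmul_smul, ← tmul_sum]
      rw [sum_push_face_comp_skip K _ hb, tmul_zero])
  have hpq : e id (p + ·) = cupCochain h a b := by
    simp only [e, cupCochain, frontFace_eq_face, backFace_eq_face]
  have hqp : e (q + ·) id = mapCochain (K.braid H) (n + 1) (cupCochain h' b a) := by
    simp only [e, cupCochain, frontFace_eq_face, backFace_eq_face]
    rfl
  rw [← hpq, ← hqp, ← key, cupOne, map_sum]
  refine Finset.sum_congr rfl fun i hi => ?_
  have hi' := Finset.mem_range.1 hi
  rw [h, coboundary_apply, ← Fin.sum_univ_eq_sum_range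
    (fun j => (-1 : ℤ) ^ j • e (skip j ∘ gap q i) (skip j ∘ (i + ·)))]
  refine Finset.sum_congr rfl fun j _ => ?_
  rw [push_tmul, push_push, push_push, affine_succAbove_comp_face j fun k hk => ?_,
    affine_succAbove_comp_face j fun k hk => ?_]
  · omega
  · simp only [gap]
    split_ifs <;> omega

end CupOne

/-! ## Permutations of the tensor factors -/

section Permute

variable {M : Type v} [AddCommGroup M]

/-- The permutation of the factors of `M^{⊗ n}` given by `s`. -/
def permuteTensor (M : Type v) [AddCommGroup M] {n : ℕ} (s : Equiv.Perm (Fin n)) :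
    (⨂[ℤ]^n M) →ₗ[ℤ] ⨂[ℤ]^n M :=
  (PiTensorProduct.reindex ℤ (fun _ => M) s).toLinearMap

theorem permuteTensor_tprod {n : ℕ} (s : Equiv.Perm (Fin n)) (f : Fin n → M) :
    permuteTensor M s (PiTensorProduct.tprod ℤ f) = PiTensorProduct.tprod ℤ (f ∘ s.symm) :=
  PiTensorProduct.reindex_tprod s f

theorem permuteTensor_mul {n : ℕ} (s t : Equiv.Perm (Fin n)) :
    permuteTensor M (s * t) = permuteTensor M s ∘ₗ permuteTensor M t := by
  ext f
  change permuteTensor M _ (PiTensorProduct.tprod ℤ f) =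
    permuteTensor M s (permuteTensor M t (PiTensorProduct.tprod ℤ f))
  simp only [permuteTensor_tprod]
  rfl

/-- The antisymmetrizer vanishes on the tensor powers of a free abelian group beyond its rank. -/
theorem sum_sign_smul_permuteTensor [Module.Free ℤ M] {n : ℕ} (h : Module.rank ℤ M < n)
    (z : ⨂[ℤ]^n M) :
    ∑ s : Equiv.Perm (Fin n), (Equiv.Perm.sign s : ℤ) • permuteTensor M s z = 0 := by
  have hz : (PiTensorProduct.tprod ℤ (s := fun _ : Fin n => M)).alternatization = 0 := by
    -- An alternating map is determined by tuples of distinct basis vectors, and there are none of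
    -- length n. `ULift` only brings the index types into one universe.
    refine Module.Basis.ext_alternating (Module.Free.chooseBasis ℤ M) fun i hi => ?_
    rw [Module.Free.rank_eq_card_chooseBasisIndex] at h
    have hi' := Cardinal.mk_le_of_injective (Equiv.ulift.symm.injective.comp
      (hi.comp Equiv.ulift.injective) : Function.Injective (_ : ULift.{v} (Fin n) → ULift.{0} _))
    simp only [Cardinal.mk_uLift, Cardinal.mk_fin, Cardinal.lift_natCast,
      Cardinal.lift_uzero] at hi'
    exact absurd h hi'.not_gt
  have hs : ∑ s : Equiv.Perm (Fin n), (Equiv.Perm.sign s : ℤ) • permuteTensor M s = 0 := by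
    ext f
    have hf := congrArg (fun φ => φ f) hz
    simp only [MultilinearMap.alternatization_apply] at hf
    -- Alternatization composes with s but reindexing composes with its inverse; inversion preserves
    -- the sign.
    rw [← Equiv.sum_comp (Equiv.inv _)] at hf
    simp only [Equiv.inv_apply, Equiv.Perm.sign_inv] at hf
    rw [LinearMap.compMultilinearMap_apply, LinearMap.sum_apply]
    exact hf
  simpa using LinearMap.congr_fun hs z

theorem permuteTensor_naturality {N : Type w} [AddCommGroup N] {n : ℕ} (s : Equiv.Perm (Fin n))
    (φ : M →ₗ[ℤ] N) :
    permuteTensor N s ∘ₗ (PiTensorProduct.map fun _ => φ) =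
      (PiTensorProduct.map fun _ => φ) ∘ₗ permuteTensor M s := by
  ext f
  change permuteTensor N s (PiTensorProduct.map (fun _ => φ) (PiTensorProduct.tprod ℤ f)) =
    PiTensorProduct.map (fun _ => φ) (permuteTensor M s (PiTensorProduct.tprod ℤ f))
  simp only [PiTensorProduct.map_tprod, permuteTensor_tprod]
  rfl

/-- A permutation of the first `n` factors commutes with appending a factor. -/
theorem permuteTensor_appendEquiv {n : ℕ} (s : Equiv.Perm (Fin n)) (t : Equiv.Perm (Fin (n + 1)))
    (hs : ∀ i : Fin n, t i.castSucc = (s i).castSucc) (hl : t (Fin.last n) = Fin.last n) :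
    permuteTensor M t ∘ₗ (appendEquiv M n).toLinearMap =
      (appendEquiv M n).toLinearMap ∘ₗ TensorProduct.map (permuteTensor M s) LinearMap.id := by
  ext f m
  change permuteTensor M t (appendEquiv M n (PiTensorProduct.tprod ℤ f ⊗ₜ[ℤ] m)) =
    appendEquiv M n (permuteTensor M s (PiTensorProduct.tprod ℤ f) ⊗ₜ[ℤ] m)
  rw [permuteTensor_tprod, appendEquiv_tprod, appendEquiv_tprod, permuteTensor_tprod]
  congr 1
  funext i
  obtain ⟨i, rfl⟩ := t.surjective i
  simp only [Function.comp_apply, Equiv.symm_apply_apply]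
  refine Fin.lastCases ?_ (fun i => ?_) i
  · simp [hl]
  · rw [hs, Fin.snoc_castSucc, Fin.snoc_castSucc, Function.comp_apply, Equiv.symm_apply_apply]

/-- The isomorphism `M^{⊗ n} ⊗ (M ⊗ M) ≅ M^{⊗ (n + 2)}`. -/
def appendTwo (M : Type v) [AddCommGroup M] (n : ℕ) :
    ((⨂[ℤ]^n M) ⊗[ℤ] (M ⊗[ℤ] M)) →ₗ[ℤ] ⨂[ℤ]^(n + 2) M :=
  (appendEquiv M (n + 1)).toLinearMap ∘ₗ
    TensorProduct.map (appendEquiv M n).toLinearMap LinearMap.id ∘ₗ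
      (TensorProduct.assoc ℤ _ M M).symm.toLinearMap

theorem appendTwo_tmul {n : ℕ} (z : ⨂[ℤ]^n M) (m m' : M) :
    appendTwo M n (z ⊗ₜ[ℤ] (m ⊗ₜ[ℤ] m')) =
      appendEquiv M (n + 1) (appendEquiv M n (z ⊗ₜ[ℤ] m) ⊗ₜ[ℤ] m') := rfl

theorem permuteTensor_appendTwo (n : ℕ) :
    permuteTensor M (Equiv.swap (Fin.last n).castSucc (Fin.last (n + 1))) ∘ₗ appendTwo M n =
      appendTwo M n ∘ₗ TensorProduct.map LinearMap.id (TensorProduct.comm ℤ M M).toLinearMap := by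
  ext f m m'
  change permuteTensor M _ (appendTwo M n (PiTensorProduct.tprod ℤ f ⊗ₜ[ℤ] (m ⊗ₜ[ℤ] m'))) =
    appendTwo M n (PiTensorProduct.tprod ℤ f ⊗ₜ[ℤ] (m' ⊗ₜ[ℤ] m))
  simp only [appendTwo_tmul, appendEquiv_tprod, permuteTensor_tprod, Equiv.symm_swap]
  congr 1
  funext i
  refine Fin.lastCases ?_ (fun i => ?_) i
  · simp
  refine Fin.lastCases ?_ (fun i => ?_) i
  · simp
  · rw [Function.comp_apply, Equiv.swap_apply_of_ne_of_ne]
    · simp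
    · simp [Fin.ext_iff, i.2.ne]
    · simp [Fin.ext_iff]; omega

theorem appendTwo_naturality {N : Type w} [AddCommGroup N] (n : ℕ) (φ : M →ₗ[ℤ] N) :
    appendTwo N n ∘ₗ TensorProduct.map (PiTensorProduct.map fun _ => φ) (TensorProduct.map φ φ) =
      (PiTensorProduct.map fun _ => φ) ∘ₗ appendTwo M n := by
  ext f m m'
  change appendTwo N n (PiTensorProduct.map (fun _ => φ) (PiTensorProduct.tprod ℤ f) ⊗ₜ[ℤ]
    (φ m ⊗ₜ[ℤ] φ m')) = PiTensorProduct.map (fun _ => φ)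
      (appendTwo M n (PiTensorProduct.tprod ℤ f ⊗ₜ[ℤ] (m ⊗ₜ[ℤ] m')))
  simp only [appendTwo_tmul, PiTensorProduct.map_tprod, appendEquiv_tprod]
  congr 1
  funext i
  refine Fin.lastCases ?_ (fun i => ?_) i
  · simp
  refine Fin.lastCases ?_ (fun i => ?_) i <;> simp

end Permute

/-! ## Morphisms of tensor powers of local systems -/

namespace LocalSystem

variable {B : Type u} [TopologicalSpace B]

/-- The tensor product of two morphisms of local systems. -/
def tensorMap {H H' : LocalSystem.{u, v} B} {K K' : LocalSystem.{u, w} B} (f : H ⟶ H')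
    (g : K ⟶ K') : H.tensor K ⟶ H'.tensor K' where
  app x := AddCommGrpCat.ofHom (TensorProduct.map (f.app x).hom.toIntLinearMap
    (g.app x).hom.toIntLinearMap).toAddMonoidHom
  naturality x y γ := by
    have hf : (f.app y).hom.toIntLinearMap ∘ₗ (H.transport γ).toIntLinearMap =
        (H'.transport γ).toIntLinearMap ∘ₗ (f.app x).hom.toIntLinearMap := by
      ext z; exact ConcreteCategory.congr_hom (f.naturality γ) z
    have hg : (g.app y).hom.toIntLinearMap ∘ₗ (K.transport γ).toIntLinearMap =
        (K'.transport γ).toIntLinearMap ∘ₗ (g.app x).hom.toIntLinearMap := by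
      ext z; exact ConcreteCategory.congr_hom (g.naturality γ) z
    have h := congrArg₂ TensorProduct.map hf hg
    rw [TensorProduct.map_comp, TensorProduct.map_comp] at h
    ext z
    exact LinearMap.congr_fun h z

/-- The permutation of the factors of `H^{⊗ n}` given by `s`. -/
def permute (H : LocalSystem.{u, v} B) {n : ℕ} (s : Equiv.Perm (Fin n)) :
    H.tensorPower n ⟶ H.tensorPower n where
  app x := AddCommGrpCat.ofHom (permuteTensor (H.obj x) s).toAddMonoidHom
  naturality x y γ := by
    ext z
    exact LinearMap.congr_fun (permuteTensor_naturality s (H.transport γ).toIntLinearMap) z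

theorem permute_mul (H : LocalSystem.{u, v} B) {n : ℕ} (s t : Equiv.Perm (Fin n)) :
    H.permute (s * t) = H.permute t ≫ H.permute s := by
  ext x z
  exact LinearMap.congr_fun (permuteTensor_mul s t) z

/-- The isomorphism `H^{⊗ n} ⊗ (H ⊗ H) ≅ H^{⊗ (n + 2)}`, as a morphism of local systems. -/
def tensorPowerAddTwo (H : LocalSystem.{u, v} B) (n : ℕ) :
    (H.tensorPower n).tensor (H.tensor H) ⟶ H.tensorPower (n + 2) where
  app x := AddCommGrpCat.ofHom (appendTwo (H.obj x) n).toAddMonoidHom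
  naturality x y γ := by
    ext z
    exact LinearMap.congr_fun (appendTwo_naturality n (H.transport γ).toIntLinearMap) z

/-- Turns the braiding, in which graded commutativity is phrased, into a transposition of the last
two tensor factors. -/
theorem tensorPowerAddTwo_permute (H : LocalSystem.{u, v} B) (n : ℕ) :
    H.tensorPowerAddTwo n ≫
        H.permute (Equiv.swap (Fin.last n).castSucc (Fin.last (n + 1))) =
      tensorMap (𝟙 _) (H.braid H) ≫ H.tensorPowerAddTwo n := by
  ext x z
  exact LinearMap.congr_fun (permuteTensor_appendTwo n) z

theorem tensorPowerSucc_permute (H : LocalSystem.{u, v} B) {n : ℕ} (s : Equiv.Perm (Fin n))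
    (t : Equiv.Perm (Fin (n + 1))) (hs : ∀ i : Fin n, t i.castSucc = (s i).castSucc)
    (hl : t (Fin.last n) = Fin.last n) :
    H.tensorPowerSucc n ≫ H.permute t =
      tensorMap (H.permute s) (𝟙 H) ≫ H.tensorPowerSucc n := by
  ext x z
  exact LinearMap.congr_fun (permuteTensor_appendEquiv s t hs hl) z

end LocalSystem

/-! ## Permutations of the factors of a cup power -/

section CupPow

variable {B : Type u} [TopologicalSpace B]

/-! ### Functoriality in the coefficients. -/

theorem push_mapCochain {H H' : LocalSystem.{u, v} B} (f : H ⟶ H') {m n : ℕ}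
    (φ : C(Simplex m, Simplex n)) (c : Cochain H m) :
    push H' φ (mapCochain f m c) = mapCochain f n (push H φ c) := by
  ext σ
  exact (ConcreteCategory.congr_hom (f.naturality _) _).symm

theorem mapCochain_tensorMap {H H' : LocalSystem.{u, v} B} {K K' : LocalSystem.{u, w} B}
    (f : H ⟶ H') (g : K ⟶ K') {p q n : ℕ} (h : p + q = n) (a : Cochain H p) (b : Cochain K q) :
    mapCochain (LocalSystem.tensorMap f g) n (cupCochain h a b) =
      cupCochain h (mapCochain f p a) (mapCochain g q b) := by
  simp only [cupCochain, push_mapCochain]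
  rfl

theorem coeffMap_comp {H H' H'' : LocalSystem.{u, v} B} (f : H ⟶ H') (g : H' ⟶ H'') {n : ℕ}
    (x : Cohomology H n) : coeffMap (f ≫ g) n x = coeffMap g n (coeffMap f n x) := by
  induction x using QuotientAddGroup.induction_on
  rfl

theorem coeffMap_id {H : LocalSystem.{u, v} B} {n : ℕ} (x : Cohomology H n) :
    coeffMap (𝟙 H) n x = x := by
  induction x using QuotientAddGroup.induction_on
  rfl

theorem coeffMap_tensorMap {H H' : LocalSystem.{u, v} B} {K K' : LocalSystem.{u, w} B}
    (f : H ⟶ H') (g : K ⟶ K') {p q n : ℕ} (h : p + q = n) (x : Cohomology H p)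
    (y : Cohomology K q) :
    coeffMap (LocalSystem.tensorMap f g) n (cup h x y) =
      cup h (coeffMap f p x) (coeffMap g q y) := by
  induction x using QuotientAddGroup.induction_on with | _ a
  induction y using QuotientAddGroup.induction_on with | _ b
  exact congrArg mkClass (Subtype.ext (mapCochain_tensorMap f g h a.1 b.1))

theorem mkClass_eq_zero {H : LocalSystem.{u, v} B} {n : ℕ} {c : cocycles H n}
    (hc : c.1 ∈ coboundaries H n) : mkClass c = 0 :=
  (QuotientAddGroup.eq_zero_iff _).2 hc

/-! ### Commutativity and associativity in cohomology. -/

/-- Graded commutativity of the cup product in odd degrees. -/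
theorem cup_comm_of_odd {H : LocalSystem.{u, v} B} {K : LocalSystem.{u, w} B} {p q n : ℕ}
    (hp : Odd p) (hq : Odd q) (h : p + q = n) (h' : q + p = n) (x : Cohomology H p)
    (y : Cohomology K q) :
    coeffMap (K.braid H) n (cup h' y x) = -cup h x y := by
  -- The degree is positive since p is odd, so coboundaries are a genuine image and the cup-one
  -- cochain of degree m can serve as primitive.
  obtain ⟨m, rfl⟩ : ∃ m, n = m + 1 := ⟨n - 1, by have := hp.pos; omega⟩
  induction x using QuotientAddGroup.induction_on with | _ a
  induction y using QuotientAddGroup.induction_on with | _ b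
  rw [eq_neg_iff_add_eq_zero]
  have hc : mapCochain (K.braid H) (m + 1) (cupCochain h' b.1 a.1) + cupCochain h a.1 b.1 ∈
      coboundaries (H.tensor K) (m + 1) := by
    refine ⟨-cupOne m a.1 b.1, ?_⟩
    rw [map_neg, coboundary_cupOne hp hq h h' a.2 b.2, neg_neg]
    exact add_comm (cupCochain h a.1 b.1) _
  exact mkClass_eq_zero (c := ⟨_, mapCochain_mem_cocycles _ _ (cup_mem_cocycles h' b.2 a.2)⟩ +
    ⟨_, cup_mem_cocycles h a.2 b.2⟩) hc

/-- Associativity of the cup product of cochains, after appending the factors. -/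
theorem mapCochain_tensorPowerSucc_cupCochain {H : LocalSystem.{u, v} B} {k p q r m l n : ℕ}
    (hm : p + q = m) (hn : m + r = n) (hl : q + r = l) (hn' : p + l = n)
    (a : Cochain (H.tensorPower k) p) (b : Cochain H q) (c : Cochain H r) :
    mapCochain (H.tensorPowerSucc (k + 1)) n
        (cupCochain hn (mapCochain (H.tensorPowerSucc k) m (cupCochain hm a b)) c) =
      mapCochain (H.tensorPowerAddTwo k) n (cupCochain hn' a (cupCochain hl b c)) := by
  have h₁ : (frontFace hn).comp (frontFace hm) = frontFace hn' := by
    simp only [frontFace, affine_comp]; rfl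
  have h₂ : (frontFace hn).comp (backFace hm) = (backFace hn').comp (frontFace hl) := by
    simp only [frontFace, backFace, affine_comp]; rfl
  have h₃ : (backFace hn').comp (backFace hl) = backFace hn := by
    simp only [backFace, affine_comp]
    congr 1
    funext i
    simp only [Function.comp_apply, Fin.ext_iff]
    omega
  simp only [cupCochain, push_mapCochain, push_tmul, push_push, h₁, h₂, h₃]
  rfl

/-- Cup powers are bracketed to the left; this regroups the last two factors, so that commutativity
applies to them. -/
theorem coeffMap_tensorPowerSucc_cup {H : LocalSystem.{u, v} B} {k p q r m l n : ℕ}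
    (hm : p + q = m) (hn : m + r = n) (hl : q + r = l) (hn' : p + l = n)
    (x : Cohomology (H.tensorPower k) p) (y : Cohomology H q) (z : Cohomology H r) :
    coeffMap (H.tensorPowerSucc (k + 1)) n
        (cup hn (coeffMap (H.tensorPowerSucc k) m (cup hm x y)) z) =
      coeffMap (H.tensorPowerAddTwo k) n (cup hn' x (cup hl y z)) := by
  induction x using QuotientAddGroup.induction_on with | _ a
  induction y using QuotientAddGroup.induction_on with | _ b
  induction z using QuotientAddGroup.induction_on with | _ c
  exact congrArg mkClass (Subtype.ext
    (mapCochain_tensorPowerSucc_cupCochain hm hn hl hn' a.1 b.1 c.1))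

/-- A permutation fixing the last slot acts on the shorter cup product alone, which drives the
induction on the length of the cup power. -/
theorem coeffMap_permute_tensorPowerSucc_cup {H : LocalSystem.{u, v} B} {k p q n : ℕ}
    (h : p + q = n) {s : Equiv.Perm (Fin k)} {t : Equiv.Perm (Fin (k + 1))}
    (hs : ∀ i : Fin k, t i.castSucc = (s i).castSucc) (hl : t (Fin.last k) = Fin.last k)
    (x : Cohomology (H.tensorPower k) p) (y : Cohomology H q) :
    coeffMap (H.permute t) n (coeffMap (H.tensorPowerSucc k) n (cup h x y)) =
      coeffMap (H.tensorPowerSucc k) n (cup h (coeffMap (H.permute s) p x) y) := by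
  rw [← coeffMap_comp, H.tensorPowerSucc_permute s t hs hl, coeffMap_comp, coeffMap_tensorMap,
    coeffMap_id]

theorem coeffMap_permute_tensorPowerAddTwo_cup {H : LocalSystem.{u, v} B} {k p d n : ℕ}
    (hd : Odd d) (h : p + (d + d) = n) (x : Cohomology (H.tensorPower k) p)
    (y : Cohomology H d) :
    coeffMap (H.permute (Equiv.swap (Fin.last k).castSucc (Fin.last (k + 1)))) n
        (coeffMap (H.tensorPowerAddTwo k) n (cup h x (cup rfl y y))) =
      -coeffMap (H.tensorPowerAddTwo k) n (cup h x (cup rfl y y)) := by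
  rw [← coeffMap_comp, LocalSystem.tensorPowerAddTwo_permute, coeffMap_comp, coeffMap_tensorMap,
    coeffMap_id, cup_comm_of_odd hd hd rfl rfl, map_neg, map_neg]

/-! ### The symmetric group acts on odd cup powers by the sign. -/

/-- Exchanging two adjacent factors changes the sign of a cup power of a class of odd degree. -/
theorem coeffMap_permute_swap_cupPow {H : LocalSystem.{u, v} B} {d : ℕ} (hd : Odd d)
    (ι : Cohomology H d) : ∀ {n : ℕ} (i : Fin n),
      coeffMap (H.permute (Equiv.swap i.castSucc i.succ)) _ (cupPow ι (n + 1)) =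
        -cupPow ι (n + 1)
  | n + 1, i => by
    -- Either the last two factors are exchanged, which is graded commutativity after regrouping, or
    -- the last factor is fixed and the induction hypothesis applies.
    refine Fin.lastCases ?_ (fun j => ?_) i
    · have h : cupPow ι (n + 1 + 1) = coeffMap (H.tensorPowerAddTwo n) _
          (cup (show d * n + (d + d) = d * (n + 1 + 1) by ring) (cupPow ι n) (cup rfl ι ι)) :=
        coeffMap_tensorPowerSucc_cup _ _ _ _ _ _ _
      rw [h]
      exact coeffMap_permute_tensorPowerAddTwo_cup hd _ _ _
    · refine (coeffMap_permute_tensorPowerSucc_cup (Nat.mul_succ d (n + 1)).symm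
        (s := Equiv.swap j.castSucc j.succ) (fun k => ?_) ?_ (cupPow ι (n + 1)) ι).trans ?_
      · rw [Fin.succ_castSucc]
        exact (Fin.castSucc_injective _).swap_apply _ _ _
      · rw [Fin.succ_castSucc]
        exact Equiv.swap_apply_of_ne_of_ne (Fin.castSucc_lt_last _).ne'
          (Fin.castSucc_lt_last _).ne'
      · rw [coeffMap_permute_swap_cupPow hd ι j, map_neg]
        exact map_neg (coeffMap (H.tensorPowerSucc (n + 1)) (d * (n + 2)))
          (cup (Nat.mul_succ d (n + 1)).symm (cupPow ι (n + 1)) ι)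

/-- A permutation of the factors multiplies a cup power of a class of odd degree by its sign. -/
theorem coeffMap_permute_cupPow {H : LocalSystem.{u, v} B} {d : ℕ} (hd : Odd d)
    (ι : Cohomology H d) {n : ℕ} (s : Equiv.Perm (Fin (n + 1))) :
    coeffMap (H.permute s) _ (cupPow ι (n + 1)) =
      (Equiv.Perm.sign s : ℤ) • cupPow ι (n + 1) := by
  -- Adjacent transpositions generate the symmetric group, even as a monoid, so no case for inverses
  -- is needed.
  have hs : s ∈ Submonoid.closure
      (Set.range fun i : Fin n => Equiv.swap i.castSucc i.succ) := by
    rw [Equiv.Perm.mclosure_swap_castSucc_succ]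
    trivial
  induction hs using Submonoid.closure_induction with
  | mem s hs =>
    obtain ⟨i, rfl⟩ := hs
    change coeffMap (H.permute (Equiv.swap i.castSucc i.succ)) _ _ = _
    rw [coeffMap_permute_swap_cupPow hd, Equiv.Perm.sign_swap Fin.castSucc_lt_succ.ne]
    simp
  | one =>
    have h : H.permute (1 : Equiv.Perm (Fin (n + 1))) = 𝟙 _ := by
      ext x z
      exact LinearMap.congr_fun (congrArg LinearEquiv.toLinearMap PiTensorProduct.reindex_refl) z
    rw [h, coeffMap_id]
    simp
  | mul s t _ _ hs ht =>
    rw [LocalSystem.permute_mul, coeffMap_comp, ht, map_zsmul, hs, smul_smul,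
      Equiv.Perm.sign_mul, Units.val_mul, mul_comm (Equiv.Perm.sign t : ℤ)]

/-- The antisymmetrizer vanishes on the cohomology of `H^{⊗ n}` if the ranks of the fibres of `H`
are smaller than `n`. -/
theorem sum_sign_smul_coeffMap_permute {H : LocalSystem.{u, v} B} {n m : ℕ}
    (hfree : ∀ x : B, Module.Free ℤ (H.fiber x))
    (hrank : ∀ x : B, Module.rank ℤ (H.fiber x) < n) (x : Cohomology (H.tensorPower n) m) :
    ∑ s : Equiv.Perm (Fin n), (Equiv.Perm.sign s : ℤ) • coeffMap (H.permute s) m x = 0 := by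
  induction x using QuotientAddGroup.induction_on with | _ c
  let e : Equiv.Perm (Fin n) → cocycles (H.tensorPower n) m := fun s =>
    (Equiv.Perm.sign s : ℤ) • ⟨mapCochain (H.permute s) m c.1,
      mapCochain_mem_cocycles (H.permute s) m c.2⟩
  -- The sum already vanishes on cochains, simplex by simplex, in the fibre over the leading vertex.
  have he : ∑ s, e s = 0 := by
    refine Subtype.ext ?_
    ext σ
    have := hfree (σ (v₀ m))
    rw [AddSubgroup.val_finsetSum, Finset.sum_apply]
    exact sum_sign_smul_permuteTensor (hrank (σ (v₀ m))) (c.1 σ)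
  have h := congrArg (QuotientAddGroup.mk'
    ((coboundaries (H.tensorPower n) m).addSubgroupOf (cocycles (H.tensorPower n) m))) he
  rw [map_sum, map_zero] at h
  exact h

end CupPow

end TwistedCohomology

end

theorem mainTheorem7 {B : Type u} [TopologicalSpace B] (g : ℕ)
    (H : TwistedCohomology.LocalSystem.{u, v} B)
    (hfree : ∀ x : B, Module.Free ℤ (H.fiber x))
    (hrank : ∀ x : B, Module.rank ℤ (H.fiber x) ≤ ((2 * g : ℕ) : Cardinal))
    {d : ℕ} (hd : Odd d) (ι : TwistedCohomology.Cohomology H d) :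
    (2 * g + 1).factorial •
      (TwistedCohomology.cupPow ι (2 * g + 1) :
        TwistedCohomology.Cohomology (H.tensorPower (2 * g + 1)) (d * (2 * g + 1))) = 0 := by
  have h := TwistedCohomology.sum_sign_smul_coeffMap_permute (n := 2 * g + 1) hfree
    (fun x => (hrank x).trans_lt (by exact_mod_cast Nat.lt_succ_self (2 * g)))
    (TwistedCohomology.cupPow ι (2 * g + 1))
  -- Each permutation contributes the square of its sign, which is 1, so the sum counts the (2g +
  -- 1)! permutations.
  simp only [TwistedCohomology.coeffMap_permute_cupPow hd, smul_smul, Int.units_coe_mul_self,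
    one_smul, Finset.sum_const, Finset.card_univ, Fintype.card_perm, Fintype.card_fin] at h
  exact h
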